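/- For $n,s\in\mathbb{Z}_{\ge 0}$ with $s\ge 1$ let $H_n^{(s)}=\sum_{k=1}^{n}k^{-s}$ and $H_n=H_n^{(1)}$ (so $H_0^{(s)}=0$). Let $p\in\mathbb{C}\setminus\mathbb{Z}_{\le 0}$, let $m\ge 1$ and $n\ge 0$ be integers, and for $a\in\{1,2,3\}$ put $$F_a:=\frac{\partial^a}{\partial x^a}\left[\frac{\partial^{m-1}}{\partial z^{m-1}}\frac{\Gamma(x+1)\Gamma(z)}{\Gamma(x+z+1)}\right]_{x=n,\;z=p}.$$ Then the series on the left converges (absolutely) and $$\begin{aligned} \sum_{k=1}^{\infty}\frac{H_{k-1}^2-H_{k-1}^{(2)}}{k\,(p+n+k)^m\binom{n+k}{k}} &=\frac{(-1)^n}{3}\sum_{k=0}^{n}\frac{(-1)^k}{(p+k)^m}\binom{n}{k}\Big\{H_n^3+2H_n^{(3)}+3H_nH_n^{(2)}-H_{n-k}^3-2H_{n-k}^{(3)}-3H_{n-k}H_{n-k}^{(2)}\Big\}\\ &\quad+\frac{(-1)^{m+n}}{(m-1)!}\Big\{\big(H_n^2+H_n^{(2)}\big)F_1-H_n\,F_2+\tfrac13F_3\Big\}.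 \end{aligned}$$ -/

import Mathlib

/-- The generalized harmonic number `H_n^{(s)} = ∑_{k=1}^n 1 / k^s` (so `H_0^{(s)} = 0`), as a
complex number; `H_n = H_n^{(1)}`. -/
noncomputable def genHarmonic (s n : ℕ) : ℂ :=
  ∑ k ∈ Finset.Icc 1 n, 1 / (k : ℂ) ^ s

/-- The mixed partial derivative
`∂_x^a [∂_z^b (Γ(x+1) Γ(z) / Γ(x+z+1))]` evaluated at `x = x₀`, `z = z₀`
(complex derivatives, the `z`-derivative being taken first). -/
noncomputable def betaPartial (a b : ℕ) (x₀ z₀ : ℂ) : ℂ :=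
  iteratedDeriv a
    (fun x : ℂ =>
      iteratedDeriv b
        (fun z : ℂ => Complex.Gamma (x + 1) * Complex.Gamma z / Complex.Gamma (x + z + 1)) z₀)
    x₀

/-- The combination `H_n^3 + 2 H_n^{(3)} + 3 H_n H_n^{(2)}`. -/
noncomputable def cubicHarmonic (n : ℕ) : ℂ :=
  genHarmonic 1 n ^ 3 + 2 * genHarmonic 3 n + 3 * genHarmonic 1 n * genHarmonic 2 n

/-!
For `k : ℕ` let `b_k(x) = ∏_{j<k} (1 - (x + 1) / (j + 1)) = (-1) ^ k * choose x k`, the coefficients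
of `(1 - t) ^ x`. Integrating the binomial series against `t ^ (z - 1)` gives
`Γ(x + 1) Γ(z) / Γ(x + z + 1) = ∑ b_k(x) / (z + k)` for `Re z > 0`; as long as `Re x ≥ -1/2`, the
bound `|b_k(x)| ≤ C (k + 1) ^ (-1/4)`, uniform for bounded `x`, makes the right side holomorphic
away from the nonpositive integers, and the identity theorem extends the expansion there
(`hasSum_beta`). By Weierstrass's theorem it may be differentiated term by term, first in `z` and
then in `x`, so that every `betaPartial` is a series in the derivatives of `b_k` at `x = n`
(`hasSum_betaPartial`).

The combination `(H_n² + H_n⁽²⁾) f⁽¹⁾ - H_n f⁽²⁾ + f⁽³⁾ / 3` of derivatives at `n`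
(`harmonicJet`) is then applied to each `b_k`. With `D(ε) = ∏_{i ≤ n} (1 + ε / i)`, whose
inverse is `1 - H_n ε + (H_n² + H_n⁽²⁾) ε² / 2 - ⋯`, this combination is twice the coefficient of
`ε³` in `f(n + ε) / D(ε)`, up to a multiple of `f(n)`. For `k ≤ n`, `b_k(n + ε)` is a constant
times a partial product of `D`, which yields the finite sum (`harmonicJet_signedBinom_of_le`). For
`k = n + 1 + j`, it is a constant times `ε D(ε) ∏_{i ≤ j} (1 - ε / i)`, and the coefficient of
`ε²` in the last product is `(H_j² - H_j⁽²⁾) / 2`, which yields the terms of the series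
(`harmonicJet_signedBinom_of_gt`).
-/

open Filter Topology Polynomial

/-! ### Termwise differentiation -/

/-- Weierstrass's theorem for derivatives of any order: a series of holomorphic functions with a
summable majorant may be differentiated term by term. -/
lemma hasSum_iteratedDeriv_of_summable_norm {F : ℕ → ℂ → ℂ} {u : ℕ → ℝ} {U : Set ℂ}
    (hu : Summable u) (hU : IsOpen U) (hF : ∀ k, DifferentiableOn ℂ (F k) U)
    (hle : ∀ k, ∀ w ∈ U, ‖F k w‖ ≤ u k) (a : ℕ) {z : ℂ} (hz : z ∈ U) :
    HasSum (fun k => iteratedDeriv a (F k) z) (iteratedDeriv a (fun w => ∑' k, F k w) z) := by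
  have hF' : ∀ a k, DifferentiableOn ℂ (iteratedDeriv a (F k)) U := by
    intro a
    induction a with
    | zero => simpa using hF
    | succ a ih => intro k; rw [iteratedDeriv_succ]; exact (ih k).deriv hU
  have key : ∀ a, TendstoLocallyUniformlyOn
      (fun (s : Finset ℕ) w => ∑ k ∈ s, iteratedDeriv a (F k) w)
      (iteratedDeriv a (fun w => ∑' k, F k w)) atTop U := by
    intro a
    induction a with
    | zero => simpa using (tendstoUniformlyOn_tsum hu hle).tendstoLocallyUniformlyOn
    | succ a ih =>
      rw [iteratedDeriv_succ]
      refine (ih.deriv (Eventually.of_forall fun s =>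
        DifferentiableOn.fun_sum fun k _ => hF' a k) hU).congr fun s w hw => ?_
      simp only [Function.comp, iteratedDeriv_succ]
      exact deriv_fun_sum fun k _ => (hF' a k).differentiableAt (hU.mem_nhds hw)
  exact (key a).tendsto_at hz

/-! ### The coefficients of the binomial series -/

/-- The coefficient of `t ^ k` in `(1 - t) ^ x`, that is `(-1) ^ k * choose x k = (-x)_k / k!`,
written as the product of the successive quotients `(j - x) / (j + 1)` for `j < k`. -/
noncomputable def signedBinom (k : ℕ) (x : ℂ) : ℂ :=
  ∏ j ∈ Finset.range k, (1 - (x + 1) / ((j : ℂ) + 1))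

lemma differentiable_signedBinom (k : ℕ) : Differentiable ℂ (signedBinom k) := by
  unfold signedBinom
  fun_prop

lemma signedBinom_succ (k : ℕ) (x : ℂ) :
    signedBinom (k + 1) x = signedBinom k x * (1 - (x + 1) / ((k : ℂ) + 1)) :=
  Finset.prod_range_succ _ _

lemma signedBinom_eq_choose (k : ℕ) (x : ℂ) :
    signedBinom k x = (-1) ^ k * Ring.choose x k := by
  induction k with
  | zero => simp [signedBinom]
  | succ k ih =>
    have h : Ring.choose x (k + 1) = Ring.choose x k * (x - k) / (k + 1) := by
      have hk : (k : ℂ) + 1 ≠ 0 := by exact_mod_cast k.succ_ne_zero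
      have hk' : (k.factorial : ℂ) ≠ 0 := by exact_mod_cast k.factorial_ne_zero
      simp only [Ring.choose_eq_smul, descPochhammer_succ_right, Polynomial.smeval_mul,
        Polynomial.smeval_sub, Polynomial.smeval_X, Polynomial.smeval_natCast, Nat.factorial_succ]
      simp
      field_simp
    have hk : (k : ℂ) + 1 ≠ 0 := by exact_mod_cast k.succ_ne_zero
    rw [signedBinom_succ, ih, h]
    field_simp
    ring

/-- The successive quotients of `signedBinom` have modulus at most `1 - 1 / (4 (k + 1))` once `k` is
large, uniformly for bounded `w` with `1 / 2 ≤ w.re`. -/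
lemma norm_one_sub_div_le {w : ℂ} {R : ℝ} (hR : ‖w‖ ≤ R) (hw : 1 / 2 ≤ w.re) {k : ℕ}
    (hk : 2 * R ^ 2 ≤ k) :
    ‖1 - w / ((k : ℂ) + 1)‖ ≤ 1 - 1 / (4 * ((k : ℝ) + 1)) := by
  set y : ℝ := (k : ℝ) + 1 with hy
  have hy1 : 1 ≤ y := by simp [hy]
  have hcast : ((k : ℂ) + 1) = (y : ℂ) := by simp [hy]
  have hnn : 0 ≤ 1 - 1 / (4 * y) := by
    rw [sub_nonneg, div_le_one (by positivity)]; linarith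
  rw [hcast, ← abs_of_nonneg hnn, ← abs_of_nonneg (norm_nonneg (1 - w / (y : ℂ))), ← sq_le_sq,
    ← Complex.normSq_eq_norm_sq, Complex.normSq_sub]
  have h1 : Complex.normSq (w / (y : ℂ)) ≤ 1 / (2 * y) := by
    rw [Complex.normSq_div, Complex.normSq_ofReal, Complex.normSq_eq_norm_sq,
      div_le_div_iff₀ (by positivity) (by positivity)]
    have : ‖w‖ ^ 2 ≤ R ^ 2 := pow_le_pow_left₀ (norm_nonneg _) hR 2
    nlinarith
  have h2 : (1 * (starRingEnd ℂ) (w / (y : ℂ))).re = w.re / y := by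
    simp [Complex.div_ofReal_re]
  rw [h2, map_one]
  have h3 : 1 / 2 / y ≤ w.re / y := div_le_div_of_nonneg_right hw (by positivity)
  have h4 : (1 - 1 / (4 * y)) ^ 2 = 1 - 1 / (2 * y) + (1 / (4 * y)) ^ 2 := by
    field_simp; ring
  have h5 : 1 / 2 / y = 1 / (2 * y) := by field_simp
  have := sq_nonneg (1 / (4 * y))
  linarith

/-- On bounded parts of `-1/2 ≤ x.re` the binomial coefficients decay at a uniform polynomial rate:
by `norm_one_sub_div_le` and Bernoulli's inequality, `‖signedBinom k x‖ * (k + 1) ^ (1 / 4)` is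
eventually decreasing in `k`. Any positive exponent would serve in place of `1 / 4`. -/
lemma exists_norm_signedBinom_le (R : ℝ) :
    ∃ C : ℝ, 0 < C ∧ ∀ (k : ℕ) (x : ℂ), ‖x‖ ≤ R → -(1 / 2) ≤ x.re →
      ‖signedBinom k x‖ ≤ C * ((k : ℝ) + 1) ^ (-(1 / 4) : ℝ) := by
  obtain ⟨N, hN⟩ := exists_nat_ge (2 * (R + 1) ^ 2)
  set M : ℝ := |R| + 2 with hM
  have hM1 : 1 ≤ M := by have := abs_nonneg R; linarith
  have hcrude : ∀ (k : ℕ) (x : ℂ), ‖x‖ ≤ R → ‖signedBinom k x‖ ≤ M ^ k := by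
    intro k x hx
    rw [signedBinom, norm_prod]
    refine (Finset.prod_le_prod (fun _ _ => norm_nonneg _) fun j _ => ?_).trans
      (by simp : ∏ j ∈ Finset.range k, M ≤ M ^ k)
    have h1 : ‖(x + 1) / ((j : ℂ) + 1)‖ ≤ ‖x + 1‖ := by
      rw [norm_div]
      refine div_le_self (norm_nonneg _) ?_
      have : ‖((j : ℂ) + 1)‖ = (j : ℝ) + 1 := by
        exact_mod_cast Complex.norm_natCast (j + 1)
      rw [this]; simp
    have h2 := norm_add_le x 1
    have h3 := norm_sub_le 1 ((x + 1) / ((j : ℂ) + 1))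
    rw [norm_one] at h2 h3
    have := le_abs_self R
    linarith
  set C : ℝ := M ^ N * ((N : ℝ) + 1) ^ (1 / 4 : ℝ) with hC
  have key : ∀ (k : ℕ) (x : ℂ), ‖x‖ ≤ R → -(1 / 2) ≤ x.re →
      ‖signedBinom k x‖ * ((k : ℝ) + 1) ^ (1 / 4 : ℝ) ≤ C := by
    intro k x hx hre
    rcases le_total k N with hk | hk
    · have hkN : (k : ℝ) ≤ N := by exact_mod_cast hk
      exact mul_le_mul ((hcrude k x hx).trans (pow_le_pow_right₀ hM1 hk))
        (Real.rpow_le_rpow (by positivity) (by linarith) (by norm_num)) (by positivity)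
        (by positivity)
    · induction k, hk using Nat.le_induction with
      | base => exact mul_le_mul_of_nonneg_right (hcrude N x hx) (by positivity)
      | succ k hk ih =>
        refine le_trans ?_ ih
        have hkN : (N : ℝ) ≤ k := by exact_mod_cast hk
        have hx1 : ‖x + 1‖ ≤ R + 1 := (norm_add_le x 1).trans (by rw [norm_one]; linarith)
        have hfac := norm_one_sub_div_le hx1
          (by rw [Complex.add_re, Complex.one_re]; linarith) (hN.trans hkN)
        rw [signedBinom_succ, norm_mul, mul_assoc]
        refine mul_le_mul_of_nonneg_left ?_ (norm_nonneg _)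
        push_cast
        set y : ℝ := (k : ℝ) + 1 with hy
        have hy1 : 1 ≤ y := by simp [hy]
        have hb : (1 + 1 / y) ^ (1 / 4 : ℝ) ≤ 1 + 1 / 4 * (1 / y) :=
          rpow_one_add_le_one_add_mul_self
            (by have : 0 ≤ 1 / y := by positivity
                linarith) (by norm_num) (by norm_num)
        have hsplit : (y + 1) ^ (1 / 4 : ℝ) = y ^ (1 / 4 : ℝ) * (1 + 1 / y) ^ (1 / 4 : ℝ) := by
          rw [← Real.mul_rpow (by positivity) (by positivity)]
          congr 1
          field_simp
        calc _ ≤ (1 - 1 / (4 * y)) * (y ^ (1 / 4 : ℝ) * (1 + 1 / 4 * (1 / y))) := by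
              rw [hsplit]
              exact mul_le_mul hfac (mul_le_mul_of_nonneg_left hb (by positivity))
                (by positivity) ((norm_nonneg _).trans hfac)
          _ = y ^ (1 / 4 : ℝ) * (1 - (1 / (4 * y)) ^ 2) := by field_simp; ring
          _ ≤ y ^ (1 / 4 : ℝ) :=
              mul_le_of_le_one_right (by positivity) (by have := sq_nonneg (1 / (4 * y)); linarith)
  refine ⟨C, by positivity, fun k x hx hre => ?_⟩
  rw [Real.rpow_neg (by positivity), ← div_eq_mul_inv, le_div_iff₀ (by positivity)]
  exact key k x hx hre

/-! ### The partial fraction expansion of the Beta function -/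

/-- Linear lower bound for the denominators `z + k` when none of them vanishes. -/
lemma exists_mul_succ_le_norm_add {z : ℂ} (hz : ∀ j : ℕ, z ≠ -(j : ℂ)) :
    ∃ δ : ℝ, 0 < δ ∧ ∀ k : ℕ, δ * ((k : ℝ) + 1) ≤ ‖z + k‖ := by
  have hpos : ∀ k : ℕ, 0 < ‖z + k‖ := fun k =>
    norm_pos_iff.2 fun h => hz k (eq_neg_of_add_eq_zero_left h)
  obtain ⟨N, hN⟩ := exists_nat_ge (2 * ‖z‖ + 1)
  obtain ⟨δ, hδ, hδN⟩ : ∃ δ : ℝ, 0 < δ ∧ ∀ k ∈ Finset.range N, δ * ((k : ℝ) + 1) ≤ ‖z + k‖ := by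
    -- The product of numbers in `(0, 1]` is a positive lower bound for each of them.
    refine ⟨∏ k ∈ Finset.range N, min 1 (‖z + k‖ / (k + 1)), ?_, fun k hk => ?_⟩
    · exact Finset.prod_pos fun k _ => lt_min one_pos (div_pos (hpos k) (by positivity))
    · rw [← le_div_iff₀ (by positivity)]
      refine le_trans ?_ (min_le_right 1 _)
      rw [← Finset.mul_prod_erase _ _ hk]
      refine mul_le_of_le_one_right (le_min zero_le_one (by positivity)) ?_
      exact Finset.prod_le_one (fun j _ => le_min zero_le_one (by positivity))
        fun j _ => min_le_left _ _
  refine ⟨min δ (1 / 2), by positivity, fun k => ?_⟩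
  by_cases hk : k < N
  · exact (mul_le_mul_of_nonneg_right (min_le_left _ _) (by positivity)).trans
      (hδN k (Finset.mem_range.2 hk))
  · refine (mul_le_mul_of_nonneg_right (min_le_right _ _) (by positivity)).trans ?_
    have h1 : (N : ℝ) ≤ k := by exact_mod_cast not_lt.1 hk
    have h2 : ‖(k : ℂ)‖ ≤ ‖z + k‖ + ‖z‖ := by
      simpa using norm_sub_le (z + k) z
    rw [Complex.norm_natCast] at h2
    linarith

lemma summable_rpow_neg_quarter_div :
    Summable fun k : ℕ => ((k : ℝ) + 1) ^ (-(1 / 4) : ℝ) / ((k : ℝ) + 1) := by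
  have h := (summable_nat_add_iff 1).2 (Real.summable_nat_rpow.2 (by norm_num : (-(5 / 4) : ℝ) < -1))
  refine h.congr fun k => ?_
  have hk : (0 : ℝ) < (k : ℝ) + 1 := by positivity
  push_cast
  rw [show (-(5 / 4) : ℝ) = -(1 / 4) - 1 by norm_num, Real.rpow_sub_one hk.ne']

lemma summable_norm_signedBinom_div_add {x : ℂ} (hx : -(1 / 2) ≤ x.re) {r : ℝ} (hr : 0 < r) :
    Summable fun k : ℕ => ‖signedBinom k x‖ / (r + k) := by
  obtain ⟨C, hC, hle⟩ := exists_norm_signedBinom_le ‖x‖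
  obtain ⟨δ, hδ, hδle⟩ := exists_mul_succ_le_norm_add (z := (r : ℂ)) (fun j h => by
    have := congrArg Complex.re h
    simp at this
    have : (0 : ℝ) ≤ j := by positivity
    linarith)
  refine Summable.of_nonneg_of_le (fun k => by positivity) (fun k => ?_)
    (summable_rpow_neg_quarter_div.mul_left (C / δ))
  have h1 : δ * ((k : ℝ) + 1) ≤ r + k := by
    have h := hδle k
    rwa [show (r : ℂ) + (k : ℂ) = ((r + k : ℝ) : ℂ) by push_cast; rfl, Complex.norm_real,
      Real.norm_of_nonneg (by positivity)] at h
  calc _ ≤ C * ((k : ℝ) + 1) ^ (-(1 / 4) : ℝ) / (δ * ((k : ℝ) + 1)) :=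
        div_le_div₀ (by positivity) (hle k x le_rfl hx) (by positivity) h1
    _ = _ := by rw [mul_div_mul_comm]

lemma hasSum_signedBinom_mul_pow (x : ℂ) {t : ℂ} (ht : ‖t‖ < 1) :
    HasSum (fun k => signedBinom k x * t ^ k) ((1 - t) ^ x) := by
  have h := (Complex.one_add_cpow_hasFPowerSeriesOnBall_zero (a := x)).hasSum (y := -t) (by
    rw [Metric.mem_eball, edist_zero_right, enorm_neg, ← ofReal_norm]
    exact ENNReal.ofReal_lt_one.2 ht)
  have hfun : (fun k => signedBinom k x * t ^ k) =
      fun k => (binomialSeries ℂ x k) fun _ => -t := by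
    funext k
    rw [binomialSeries_apply, signedBinom_eq_choose, List.ofFn_const, List.prod_replicate,
      smul_eq_mul, neg_pow t]
    ring
  rwa [zero_add, ← sub_eq_add_neg, ← hfun] at h

open MeasureTheory Set in
/-- Integrate the binomial series of `(1 - t) ^ x` against `t ^ (z - 1)` over `(0, 1)`. -/
lemma hasSum_beta_of_re_pos {x z : ℂ} (hx : -(1 / 2) ≤ x.re) (hz : 0 < z.re) :
    HasSum (fun k : ℕ => signedBinom k x / (z + k))
      (Complex.Gamma (x + 1) * Complex.Gamma z / Complex.Gamma (x + z + 1)) := by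
  set F : ℕ → ℝ → ℂ := fun k t => signedBinom k x * (t : ℂ) ^ (z + k - 1) with hF
  have hre : ∀ k : ℕ, 0 < (z + k).re := fun k => by
    rw [Complex.add_re, Complex.natCast_re]; positivity
  have hint : ∀ k : ℕ, IntegrableOn (F k) (Ioo 0 1) := fun k => by
    have h := intervalIntegral.intervalIntegrable_cpow' (a := 0) (b := 1) (r := z + k - 1)
      (by have := hre k; rw [Complex.sub_re, Complex.one_re]; linarith)
    rw [intervalIntegrable_iff_integrableOn_Ioo_of_le zero_le_one] at h
    exact h.const_mul _
  have hval : ∀ k : ℕ, ∫ t in Ioo (0 : ℝ) 1, F k t = signedBinom k x / (z + k) := fun k => by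
    have hk := hre k
    rw [← integral_Ioc_eq_integral_Ioo, ← intervalIntegral.integral_of_le zero_le_one]
    simp only [hF]
    rw [intervalIntegral.integral_const_mul, integral_cpow (Or.inl (by
      rw [Complex.sub_re, Complex.one_re]; linarith)), sub_add_cancel,
      Complex.ofReal_zero, Complex.ofReal_one, Complex.one_cpow, Complex.zero_cpow, sub_zero,
      mul_one_div]
    intro h0
    rw [h0] at hk
    simp at hk
  have hnorm : ∀ k : ℕ, ∫ t in Ioo (0 : ℝ) 1, ‖F k t‖ = ‖signedBinom k x‖ / (z.re + k) :=
    fun k => by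
    have hk : 0 < z.re + k := by positivity
    have h1 : ∀ t ∈ Ioo (0 : ℝ) 1, ‖F k t‖ = ‖signedBinom k x‖ * t ^ (z.re + k - 1) :=
      fun t ht => by
      simp only [hF]
      rw [norm_mul, Complex.norm_cpow_eq_rpow_re_of_pos ht.1]
      simp
    rw [setIntegral_congr_fun measurableSet_Ioo h1, ← integral_Ioc_eq_integral_Ioo,
      ← intervalIntegral.integral_of_le zero_le_one, intervalIntegral.integral_const_mul,
      integral_rpow (Or.inl (by linarith)), sub_add_cancel, Real.one_rpow,
      Real.zero_rpow hk.ne', sub_zero, mul_one_div]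
  have hsum := hasSum_integral_of_summable_integral_norm (μ := volume.restrict (Ioo (0 : ℝ) 1))
    hint (by simpa only [hnorm] using summable_norm_signedBinom_div_add hx hz)
  simp only [hval] at hsum
  suffices heq : Complex.Gamma (x + 1) * Complex.Gamma z / Complex.Gamma (x + z + 1) =
      ∫ t in Ioo (0 : ℝ) 1, ∑' k, F k t by rwa [heq]
  have hx1 : 0 < (x + 1).re := by rw [Complex.add_re, Complex.one_re]; linarith
  have hne : Complex.Gamma (x + z + 1) ≠ 0 := Complex.Gamma_ne_zero_of_re_pos (by
    rw [Complex.add_re, Complex.add_re, Complex.one_re] at *; linarith)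
  rw [div_eq_iff hne, mul_comm (Complex.Gamma (x + 1)),
    Complex.Gamma_mul_Gamma_eq_betaIntegral hz hx1, show z + (x + 1) = x + z + 1 by ring,
    mul_comm, Complex.betaIntegral, intervalIntegral.integral_of_le zero_le_one,
    integral_Ioc_eq_integral_Ioo]
  congr 1
  refine setIntegral_congr_fun measurableSet_Ioo fun t ht => ?_
  have ht0 : (t : ℂ) ≠ 0 := by exact_mod_cast ht.1.ne'
  have hs := (hasSum_signedBinom_mul_pow x (t := (t : ℂ)) (by
    rw [Complex.norm_real, Real.norm_of_nonneg ht.1.le]; exact ht.2)).mul_left ((t : ℂ) ^ (z - 1))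
  rw [add_sub_cancel_right, ← hs.tsum_eq]
  refine tsum_congr fun k => ?_
  simp only [hF]
  rw [show z + k - 1 = (z - 1) + k by ring, Complex.cpow_add _ _ ht0, Complex.cpow_natCast]
  ring

/-- The bound of `exists_mul_succ_le_norm_add`, uniform on a neighbourhood. -/
lemma exists_ball_mul_succ_le {z₀ : ℂ} (hz : ∀ j : ℕ, z₀ ≠ -(j : ℂ)) :
    ∃ δ : ℝ, 0 < δ ∧ ∀ z ∈ Metric.ball z₀ δ, ∀ k : ℕ, δ * ((k : ℝ) + 1) ≤ ‖z + k‖ := by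
  obtain ⟨δ, hδ, hle⟩ := exists_mul_succ_le_norm_add hz
  refine ⟨δ / 2, by positivity, fun z hzb k => ?_⟩
  have h1 := hle k
  have h2 : ‖z₀ + k‖ ≤ ‖z + k‖ + ‖z - z₀‖ := by
    have := norm_sub_le (z + k) (z - z₀)
    rwa [show z + k - (z - z₀) = z₀ + k by ring] at this
  rw [mem_ball_iff_norm] at hzb
  have h3 : 0 ≤ δ * (k : ℝ) := by positivity
  linarith

lemma add_natCast_ne_zero_of_le {δ : ℝ} (hδ : 0 < δ) {z : ℂ} {k : ℕ}
    (h : δ * ((k : ℝ) + 1) ≤ ‖z + k‖) : z + k ≠ 0 :=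
  norm_pos_iff.1 (lt_of_lt_of_le (by positivity) h)

lemma differentiableAt_const_div_add {c d z : ℂ} (h : z + d ≠ 0) :
    DifferentiableAt ℂ (fun z => c / (z + d)) z :=
  (differentiableAt_const c).div (by fun_prop) h

lemma norm_signedBinom_div_le {x : ℂ} {C δ : ℝ} (hδ : 0 < δ) {k : ℕ} {z : ℂ}
    (hC : ‖signedBinom k x‖ ≤ C * ((k : ℝ) + 1) ^ (-(1 / 4) : ℝ))
    (hz : δ * ((k : ℝ) + 1) ≤ ‖z + k‖) :
    ‖signedBinom k x / (z + k)‖ ≤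
      C / δ * (((k : ℝ) + 1) ^ (-(1 / 4) : ℝ) / ((k : ℝ) + 1)) := by
  rw [norm_div, ← mul_div_mul_comm]
  exact div_le_div₀ ((norm_nonneg _).trans hC) hC (by positivity) hz

/-- Partial fraction expansion of the Beta function, extended from `0 < z.re` by the identity theorem
on the complement of the nonpositive integers, which is connected since its complement is
countable. -/
lemma hasSum_beta {x z : ℂ} (hx : -(1 / 2) ≤ x.re) (hz : ∀ j : ℕ, z ≠ -(j : ℂ)) :
    HasSum (fun k : ℕ => signedBinom k x / (z + k))
      (Complex.Gamma (x + 1) * Complex.Gamma z / Complex.Gamma (x + z + 1)) := by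
  set U : Set ℂ := (Set.range fun j : ℕ => -(j : ℂ))ᶜ with hU
  have memU : ∀ w, w ∈ U ↔ ∀ j : ℕ, w ≠ -(j : ℂ) := fun w => by
    simp [hU, eq_comm]
  obtain ⟨C, hC, hle⟩ := exists_norm_signedBinom_le ‖x‖
  have hUconn : IsPreconnected U :=
    ((Set.countable_range _).isConnected_compl_of_one_lt_rank (by simp)).isPreconnected
  have hball : ∀ w ∈ U, ∃ δ > 0, Metric.ball w δ ⊆ U ∧ (∀ v ∈ Metric.ball w δ, Summable
      fun k : ℕ => signedBinom k x / (v + k)) ∧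
      DifferentiableOn ℂ (fun v => ∑' k : ℕ, signedBinom k x / (v + k)) (Metric.ball w δ) := by
    intro w hw
    obtain ⟨δ, hδ, hδle⟩ := exists_ball_mul_succ_le ((memU w).1 hw)
    have hbd : ∀ (k : ℕ), ∀ v ∈ Metric.ball w δ, ‖signedBinom k x / (v + k)‖ ≤ _ :=
      fun k v hv => norm_signedBinom_div_le hδ (hle k x le_rfl hx) (hδle v hv k)
    have hs := summable_rpow_neg_quarter_div.mul_left (C / δ)
    refine ⟨δ, hδ, fun v hv => (memU v).2 fun j hj =>
      add_natCast_ne_zero_of_le hδ (hδle v hv j) (by rw [hj]; ring),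
      fun v hv => hs.of_norm_bounded fun k => hbd k v hv, ?_⟩
    refine Complex.differentiableOn_tsum_of_summable_norm hs (fun k v hv => ?_)
      Metric.isOpen_ball hbd
    exact (differentiableAt_const_div_add
      (add_natCast_ne_zero_of_le hδ (hδle v hv k))).differentiableWithinAt
  have hUopen : IsOpen U := Metric.isOpen_iff.2 fun w hw => by
    obtain ⟨δ, hδ, h, -⟩ := hball w hw
    exact ⟨δ, hδ, h⟩
  have hf : AnalyticOnNhd ℂ (fun v => ∑' k : ℕ, signedBinom k x / (v + k)) U := by
    refine DifferentiableOn.analyticOnNhd (fun w hw => ?_) hUopen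
    obtain ⟨δ, hδ, -, -, h⟩ := hball w hw
    exact (h.differentiableAt (Metric.ball_mem_nhds w hδ)).differentiableWithinAt
  have hg : AnalyticOnNhd ℂ (fun v => Complex.Gamma (x + 1) * Complex.Gamma v /
      Complex.Gamma (x + v + 1)) U := by
    refine DifferentiableOn.analyticOnNhd (fun w hw => ?_) hUopen
    have h1 := Complex.differentiableAt_Gamma w ((memU w).1 hw)
    -- `x + v + 1` may be a pole of `Γ`; Mathlib's `1 / Γ` is nevertheless entire.
    have h2 : DifferentiableAt ℂ (fun v => (Complex.Gamma (x + v + 1))⁻¹) w :=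
      (Complex.differentiable_one_div_Gamma _).comp w
        (by fun_prop : DifferentiableAt ℂ (fun v => x + v + 1) w)
    simp only [div_eq_mul_inv]
    exact ((h1.const_mul _).mul h2).differentiableWithinAt
  have h1U : (1 : ℂ) ∈ U := (memU 1).2 fun j hj => by
    have := congrArg Complex.re hj
    simp at this
    have : (0 : ℝ) ≤ j := by positivity
    linarith
  have heq := hf.eqOn_of_preconnected_of_eventuallyEq hg hUconn h1U (by
    have : {w : ℂ | 0 < w.re} ∈ 𝓝 (1 : ℂ) :=
      (isOpen_lt continuous_const Complex.continuous_re).mem_nhds (by simp)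
    filter_upwards [this] with w hw using (hasSum_beta_of_re_pos hx hw).tsum_eq)
  obtain ⟨δ, hδ, -, h, -⟩ := hball z ((memU z).2 hz)
  have hs := (h z (Metric.mem_ball_self hδ)).hasSum
  have hval : ∑' k : ℕ, signedBinom k x / (z + k) = _ := heq ((memU z).2 hz)
  rwa [hval] at hs

lemma iteratedDeriv_const_div_add (b : ℕ) (c d z : ℂ) :
    iteratedDeriv b (fun z => c / (z + d)) z =
      (-1) ^ b * (b.factorial : ℂ) * (c / (z + d) ^ (b + 1)) := by
  have h := congrFun (iter_deriv_inv_linear b 1 d) z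
  simp only [div_eq_mul_inv, iteratedDeriv_const_mul_field, iteratedDeriv_eq_iterate]
  simp only [one_mul, one_pow, mul_one] at h
  rw [h, show (-1 - b : ℤ) = -((b + 1 : ℕ) : ℤ) by push_cast; ring, zpow_neg, zpow_natCast]
  ring

lemma hasSum_iteratedDeriv_beta (b : ℕ) {x z : ℂ} (hx : -(1 / 2) ≤ x.re)
    (hz : ∀ j : ℕ, z ≠ -(j : ℂ)) :
    HasSum (fun k : ℕ => (-1) ^ b * (b.factorial : ℂ) * (signedBinom k x / (z + k) ^ (b + 1)))
      (iteratedDeriv b (fun z : ℂ =>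
        Complex.Gamma (x + 1) * Complex.Gamma z / Complex.Gamma (x + z + 1)) z) := by
  obtain ⟨C, hC, hle⟩ := exists_norm_signedBinom_le ‖x‖
  obtain ⟨δ, hδ, hδle⟩ := exists_ball_mul_succ_le hz
  have h := hasSum_iteratedDeriv_of_summable_norm
    (F := fun k v => signedBinom k x / (v + k)) (U := Metric.ball z δ)
    (summable_rpow_neg_quarter_div.mul_left (C / δ)) Metric.isOpen_ball
    (fun k v hv => (differentiableAt_const_div_add
      (add_natCast_ne_zero_of_le hδ (hδle v hv k))).differentiableWithinAt)
    (fun k v hv => norm_signedBinom_div_le hδ (hle k x le_rfl hx) (hδle v hv k)) b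
    (Metric.mem_ball_self hδ)
  simp only [iteratedDeriv_const_div_add] at h
  rwa [Filter.EventuallyEq.iteratedDeriv_eq b (f := fun v => ∑' k : ℕ, signedBinom k x / (v + k))
    (g := fun z : ℂ => Complex.Gamma (x + 1) * Complex.Gamma z / Complex.Gamma (x + z + 1))] at h
  filter_upwards [Metric.ball_mem_nhds z hδ] with v hv
  exact (hasSum_beta hx fun j hj =>
    add_natCast_ne_zero_of_le hδ (hδle v hv j) (by rw [hj]; ring)).tsum_eq

lemma hasSum_betaPartial (a b n : ℕ) {p : ℂ} (hp : ∀ j : ℕ, p ≠ -(j : ℂ)) :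
    HasSum (fun k : ℕ => (-1) ^ b * (b.factorial : ℂ) *
        (iteratedDeriv a (signedBinom k) n / (p + k) ^ (b + 1)))
      (betaPartial a b n p) := by
  obtain ⟨C, hC, hle⟩ := exists_norm_signedBinom_le (n + 1)
  obtain ⟨δ, hδ, hδle⟩ := exists_mul_succ_le_norm_add hp
  have hre : ∀ x ∈ Metric.ball (n : ℂ) (1 / 2), ‖x‖ ≤ n + 1 ∧ -(1 / 2) ≤ x.re := by
    intro x hx
    rw [mem_ball_iff_norm] at hx
    have h1 := norm_add_le (n : ℂ) (x - n)
    rw [add_sub_cancel, Complex.norm_natCast] at h1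
    have h2 := (abs_le.1 (Complex.abs_re_le_norm (x - n))).1
    rw [Complex.sub_re, Complex.natCast_re] at h2
    have h3 : (0 : ℝ) ≤ n := by positivity
    constructor <;> linarith
  have h := hasSum_iteratedDeriv_of_summable_norm
    (F := fun k x => ((-1) ^ b * (b.factorial : ℂ) / (p + k) ^ (b + 1)) * signedBinom k x)
    (U := Metric.ball (n : ℂ) (1 / 2))
    (u := fun k => ‖((-1) ^ b * (b.factorial : ℂ))‖ / δ ^ b *
      (C / δ * (((k : ℝ) + 1) ^ (-(1 / 4) : ℝ) / ((k : ℝ) + 1))))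
    ((summable_rpow_neg_quarter_div.mul_left (C / δ)).mul_left _) Metric.isOpen_ball
    (fun k => ((differentiable_signedBinom k).const_mul _).differentiableOn)
    (fun k x hx => ?_) a (Metric.mem_ball_self (by norm_num))
  · simp only [iteratedDeriv_const_mul_field] at h
    rw [betaPartial]
    convert h using 1
    · ext k; ring
    · refine Filter.EventuallyEq.iteratedDeriv_eq a ?_
      filter_upwards [Metric.ball_mem_nhds (n : ℂ) (by norm_num : (0 : ℝ) < 1 / 2)] with x hx
      rw [← (hasSum_iteratedDeriv_beta b (hre x hx).2 hp).tsum_eq]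
      exact tsum_congr fun k => by ring
  · have h1 := norm_signedBinom_div_le hδ (hle k x (hre x hx).1 (hre x hx).2) (hδle k)
    have h2 : δ ≤ ‖p + k‖ := le_trans (by nlinarith [Nat.cast_nonneg (α := ℝ) k]) (hδle k)
    rw [show ((-1) ^ b * (b.factorial : ℂ) / (p + k) ^ (b + 1)) * signedBinom k x =
      ((-1) ^ b * (b.factorial : ℂ)) / (p + k) ^ b * (signedBinom k x / (p + k)) by
        rw [pow_succ]; simp only [div_eq_mul_inv, mul_inv]; ring, norm_mul, norm_div, norm_pow (p + k)]
    exact mul_le_mul (div_le_div_of_nonneg_left (norm_nonneg _) (by positivity)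
      (pow_le_pow_left₀ hδ.le h2 b)) h1 (norm_nonneg _) (by positivity)

/-! ### Taylor coefficients of the binomial coefficients at an integer -/

/-- Taylor coefficients at `c` of a polynomial in `x - c`. -/
lemma iteratedDeriv_eval_sub (P : ℂ[X]) (c : ℂ) (a : ℕ) :
    iteratedDeriv a (fun x => P.eval (x - c)) c = a.factorial * P.coeff a := by
  have h : ∀ a, iteratedDeriv a (fun x => P.eval x) = fun x => (derivative^[a] P).eval x := by
    intro a
    induction a with
    | zero => simp
    | succ a ih =>
      rw [iteratedDeriv_succ, ih, Function.iterate_succ_apply']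
      funext x
      exact Polynomial.deriv _
  rw [iteratedDeriv_comp_sub_const a (fun x => P.eval x) c, h]
  simp only [sub_self]
  rw [← coeff_zero_eq_eval_zero, coeff_iterate_derivative, zero_add, Nat.descFactorial_self,
    nsmul_eq_mul]

/-- The polynomial `∏ i ∈ s, (1 + f i * X)`. -/
noncomputable def linearProd (s : Finset ℕ) (f : ℕ → ℂ) : ℂ[X] :=
  ∏ i ∈ s, (1 + C (f i) * X)

lemma linearProd_eval (s : Finset ℕ) (f : ℕ → ℂ) (x : ℂ) :
    (linearProd s f).eval x = ∏ i ∈ s, (1 + f i * x) := by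
  simp [linearProd, eval_prod]

/-- Newton's identities up to degree three: the coefficients of `∏ (1 + f i * X)` in terms of the
power sums of `f`. -/
lemma linearProd_coeff (s : Finset ℕ) (f : ℕ → ℂ) :
    (linearProd s f).coeff 0 = 1 ∧
    (linearProd s f).coeff 1 = ∑ i ∈ s, f i ∧
    (linearProd s f).coeff 2 = ((∑ i ∈ s, f i) ^ 2 - ∑ i ∈ s, f i ^ 2) / 2 ∧
    (linearProd s f).coeff 3 = ((∑ i ∈ s, f i) ^ 3 - 3 * (∑ i ∈ s, f i) * (∑ i ∈ s, f i ^ 2)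
      + 2 * ∑ i ∈ s, f i ^ 3) / 6 := by
  induction s using Finset.induction_on with
  | empty => simp [linearProd, coeff_one]
  | insert i s hi ih =>
    obtain ⟨h0, h1, h2, h3⟩ := ih
    have hprod : linearProd (insert i s) f = linearProd s f + C (f i) * (X * linearProd s f) := by
      rw [linearProd, Finset.prod_insert hi, ← linearProd]; ring
    simp only [hprod, coeff_add, coeff_C_mul, coeff_X_mul, coeff_X_mul_zero,
      show (3 : ℕ) = 2 + 1 from rfl, show (2 : ℕ) = 1 + 1 from rfl]
    simp only [Finset.sum_insert hi]
    simp only [Nat.reduceAdd, h0, h1, h2, h3]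
    refine ⟨by ring, by ring, by ring, by ring⟩

lemma sum_Ioc_inv_pow (n k s : ℕ) :
    ∑ i ∈ Finset.Ioc (n - k) n, ((i : ℂ)⁻¹) ^ s = genHarmonic s n - genHarmonic s (n - k) := by
  have h : ∀ N, genHarmonic s N = ∑ i ∈ Finset.Ioc 0 N, ((i : ℂ)⁻¹) ^ s := fun N => by
    simp only [genHarmonic, one_div, inv_pow]
    rfl
  rw [h, h, eq_sub_iff_add_eq, add_comm]
  exact Finset.sum_Ioc_consecutive (fun i => ((i : ℂ)⁻¹) ^ s) (Nat.zero_le _) (Nat.sub_le n k)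

/-- For `k ≤ n`, in terms of `ε = x - n`: the binomial coefficient is
`(-1) ^ k * choose n k * ∏_{n-k < i ≤ n} (1 + ε / i)`. -/
lemma signedBinom_of_le (n : ℕ) (x : ℂ) {k : ℕ} (hk : k ≤ n) :
    signedBinom k x = (C ((-1) ^ k * (n.choose k : ℂ)) *
      linearProd (Finset.Ioc (n - k) n) fun i => (i : ℂ)⁻¹).eval (x - n) := by
  rw [eval_mul, eval_C, linearProd_eval]
  induction k with
  | zero => simp [signedBinom]
  | succ k ih =>
    have hset : Finset.Ioc (n - (k + 1)) n = insert (n - k) (Finset.Ioc (n - k) n) := by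
      ext i; simp only [Finset.mem_Ioc, Finset.mem_insert]; omega
    have hk1 : (k : ℂ) + 1 ≠ 0 := by exact_mod_cast k.succ_ne_zero
    have hnk : (n : ℂ) - k ≠ 0 := by
      rw [sub_ne_zero]; exact_mod_cast (show n ≠ k by omega)
    have hch : (n.choose (k + 1) : ℂ) * (k + 1) = n.choose k * (n - k) := by
      have h := Nat.choose_succ_right_eq n k
      rw [← Nat.cast_sub (by omega : k ≤ n)]
      exact_mod_cast h
    rw [signedBinom_succ, ih (by omega), hset, Finset.prod_insert (by simp),
      Nat.cast_sub (by omega : k ≤ n), eq_div_of_mul_eq hk1 hch]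
    field_simp
    ring

/-- Beyond `k = n` the factor `j = n` of the defining product contributes a simple zero at `x = n`.
The interval is written `Ioc (n - n) n`, rather than `Ioc 0 n`, to match `signedBinom_of_le` at
`k = n`. -/
lemma signedBinom_of_gt (n j : ℕ) (x : ℂ) :
    signedBinom (j + (n + 1)) x =
      (C ((-1) ^ (n + 1) / (((j + 1 : ℕ) : ℂ) * ((n + (j + 1)).choose (j + 1) : ℂ))) *
        (X * (linearProd (Finset.Ioc (n - n) n) (fun i => (i : ℂ)⁻¹) *
          linearProd (Finset.Icc 1 j) fun i => -(i : ℂ)⁻¹))).eval (x - n) := by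
  simp only [eval_mul, eval_C, eval_X, linearProd_eval]
  induction j with
  | zero =>
    have hn1 : (n : ℂ) + 1 ≠ 0 := by exact_mod_cast n.succ_ne_zero
    rw [zero_add, signedBinom_succ, signedBinom_of_le n x le_rfl, eval_mul, eval_C, linearProd_eval]
    simp
    field_simp
    ring
  | succ j ih =>
    have hset : Finset.Icc 1 (j + 1) = insert (j + 1) (Finset.Icc 1 j) := by
      ext i; simp only [Finset.mem_Icc, Finset.mem_insert]; omega
    have hj1 : (j : ℂ) + 1 ≠ 0 := by exact_mod_cast j.succ_ne_zero
    have hj2 : (j : ℂ) + 1 + 1 ≠ 0 := by exact_mod_cast (j + 1).succ_ne_zero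
    have hnj : (j : ℂ) + (n + 1) + 1 ≠ 0 := by exact_mod_cast (j + (n + 1)).succ_ne_zero
    have hc0 : ((n + (j + 1)).choose (j + 1) : ℂ) ≠ 0 := by
      exact_mod_cast (Nat.choose_pos (by omega)).ne'
    have hch : ((n + (j + 1 + 1)).choose (j + 1 + 1) : ℂ) * (j + 1 + 1) =
        (j + (n + 1) + 1) * (n + (j + 1)).choose (j + 1) := by
      have h := Nat.add_one_mul_choose_eq (n + (j + 1)) (j + 1)
      have h' : ((n + (j + 1)).succ : ℂ) * (n + (j + 1)).choose (j + 1) =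
        (n + (j + 1)).succ.choose (j + 1).succ * (j + 1).succ := by exact_mod_cast h
      push_cast [Nat.succ_eq_add_one] at h'
      rw [show n + (j + 1 + 1) = n + (j + 1) + 1 by ring, ← h']
      ring
    rw [show j + 1 + (n + 1) = (j + (n + 1)) + 1 by ring, signedBinom_succ, ih, hset,
      Finset.prod_insert (by simp), eq_div_of_mul_eq hj2 hch]
    push_cast
    field_simp
    ring

/-! ### The combination of derivatives and the series -/

/-- The combination `(H_n² + H_n⁽²⁾) f⁽¹⁾ - H_n f⁽²⁾ + f⁽³⁾ / 3` of the derivatives of `f` at `n`. -/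
noncomputable def harmonicJet (n : ℕ) (f : ℂ → ℂ) : ℂ :=
  (genHarmonic 1 n ^ 2 + genHarmonic 2 n) * iteratedDeriv 1 f n
    - genHarmonic 1 n * iteratedDeriv 2 f n + iteratedDeriv 3 f n / 3

lemma harmonicJet_eval_sub (n : ℕ) (P : ℂ[X]) :
    harmonicJet n (fun x => P.eval (x - n)) =
      (genHarmonic 1 n ^ 2 + genHarmonic 2 n) * P.coeff 1
        - 2 * genHarmonic 1 n * P.coeff 2 + 2 * P.coeff 3 := by
  simp only [harmonicJet, iteratedDeriv_eval_sub, Nat.factorial]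
  push_cast
  ring

lemma harmonicJet_signedBinom_of_le {n k : ℕ} (hk : k ≤ n) :
    harmonicJet n (signedBinom k) =
      (-1) ^ k * (n.choose k : ℂ) * (cubicHarmonic n - cubicHarmonic (n - k)) / 3 := by
  rw [show signedBinom k = _ from funext fun x => signedBinom_of_le n x hk, harmonicJet_eval_sub]
  obtain ⟨-, h1, h2, h3⟩ := linearProd_coeff (Finset.Ioc (n - k) n) fun i => (i : ℂ)⁻¹
  have hs := sum_Ioc_inv_pow n k
  have hs1 := hs 1
  simp only [pow_one] at hs1
  simp only [coeff_C_mul, h1, h2, h3, hs1, hs, cubicHarmonic]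
  ring

/-- The harmonic numbers of index `n` cancel, since `1 - H_n ε + (H_n² + H_n⁽²⁾) ε² / 2` inverts
`∏_{i ≤ n} (1 + ε / i)` modulo `ε³`. -/
lemma harmonicJet_signedBinom_of_gt (n j : ℕ) :
    harmonicJet n (signedBinom (j + (n + 1))) =
      (-1) ^ (n + 1) * (genHarmonic 1 j ^ 2 - genHarmonic 2 j) /
        (((j + 1 : ℕ) : ℂ) * ((n + (j + 1)).choose (j + 1) : ℂ)) := by
  rw [show signedBinom (j + (n + 1)) = _ from funext fun x => signedBinom_of_gt n j x,
    harmonicJet_eval_sub]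
  obtain ⟨a0, a1, a2, -⟩ := linearProd_coeff (Finset.Ioc (n - n) n) fun i => (i : ℂ)⁻¹
  obtain ⟨b0, b1, b2, -⟩ := linearProd_coeff (Finset.Icc 1 j) fun i => -(i : ℂ)⁻¹
  have hs := sum_Ioc_inv_pow n n
  have hs1 := hs 1
  simp only [pow_one] at hs1
  have ht1 : ∑ i ∈ Finset.Icc 1 j, -(i : ℂ)⁻¹ = -genHarmonic 1 j := by
    simp [genHarmonic]
  have ht2 : ∑ i ∈ Finset.Icc 1 j, (-(i : ℂ)⁻¹) ^ 2 = genHarmonic 2 j := by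
    simp [genHarmonic]
  have h0 : ∀ s, genHarmonic s (n - n) = 0 := fun s => by simp [genHarmonic]
  rw [hs1, h0, sub_zero] at a1
  rw [hs1, hs, h0, h0, sub_zero, sub_zero] at a2
  rw [ht1] at b1
  rw [ht1, ht2] at b2
  generalize linearProd (Finset.Ioc (n - n) n) (fun i => (i : ℂ)⁻¹) = A at *
  generalize linearProd (Finset.Icc 1 j) (fun i => -(i : ℂ)⁻¹) = B at *
  have c1 : (X * (A * B)).coeff 1 = 1 := by
    rw [coeff_X_mul _ 0, mul_coeff_zero, a0, b0, one_mul]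
  have c2 : (X * (A * B)).coeff 2 = genHarmonic 1 n - genHarmonic 1 j := by
    rw [coeff_X_mul _ 1, mul_coeff_one, a0, a1, b0, b1]; ring
  have c3 : (X * (A * B)).coeff 3 = (genHarmonic 1 n ^ 2 - genHarmonic 2 n) / 2
      - genHarmonic 1 n * genHarmonic 1 j + (genHarmonic 1 j ^ 2 - genHarmonic 2 j) / 2 := by
    rw [coeff_X_mul _ 2, coeff_mul]
    simp [Finset.Nat.antidiagonal_succ, a0, a1, a2, b0, b1, b2]
    ring
  simp only [coeff_C_mul, c1, c2, c3]
  ring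

/-- The series over `k ≥ 1` is indexed by `j = k - 1 ≥ 0`. -/
theorem theorem3p11 (p : ℂ) (hp : ∀ j : ℕ, p ≠ -(j : ℂ)) (m n : ℕ) (hm : 1 ≤ m) :
    HasSum
      (fun j : ℕ =>
        (genHarmonic 1 j ^ 2 - genHarmonic 2 j) /
          (((j + 1 : ℕ) : ℂ) * (p + n + ((j + 1 : ℕ) : ℂ)) ^ m *
            ((n + (j + 1)).choose (j + 1) : ℂ)))
      ((-1) ^ n / 3 *
          ∑ k ∈ Finset.range (n + 1),
            (-1) ^ k / (p + k) ^ m * (n.choose k : ℂ) *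
              (cubicHarmonic n - cubicHarmonic (n - k))
        + (-1) ^ (m + n) * (genHarmonic 1 n ^ 2 + genHarmonic 2 n) / ((m - 1).factorial : ℂ) *
            betaPartial 1 (m - 1) n p
        - (-1) ^ (m + n) * genHarmonic 1 n / ((m - 1).factorial : ℂ) *
            betaPartial 2 (m - 1) n p
        + (-1) ^ (m + n) / (3 * ((m - 1).factorial : ℂ)) *
            betaPartial 3 (m - 1) n p) := by
  obtain ⟨b, rfl⟩ : ∃ b, m = b + 1 := ⟨m - 1, by omega⟩
  rw [Nat.add_sub_cancel]
  have hb : (b.factorial : ℂ) ≠ 0 := by exact_mod_cast b.factorial_ne_zero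
  have hsq : ((-1 : ℂ) ^ b) ^ 2 = 1 := by rw [← pow_mul, mul_comm, pow_mul]; simp
  have hsqn : ((-1 : ℂ) ^ n) ^ 2 = 1 := by rw [← pow_mul, mul_comm, pow_mul]; simp
  have hall : HasSum (fun k : ℕ => (-1) ^ (n + 1) * harmonicJet n (signedBinom k) /
      (p + k) ^ (b + 1))
      ((-1) ^ (b + 1 + n) * (genHarmonic 1 n ^ 2 + genHarmonic 2 n) / (b.factorial : ℂ) *
            betaPartial 1 b n p
        - (-1) ^ (b + 1 + n) * genHarmonic 1 n / (b.factorial : ℂ) * betaPartial 2 b n p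
        + (-1) ^ (b + 1 + n) / (3 * (b.factorial : ℂ)) * betaPartial 3 b n p) := by
    have h := ((((hasSum_betaPartial 1 b n hp).mul_left
        ((-1) ^ (b + 1 + n) * (genHarmonic 1 n ^ 2 + genHarmonic 2 n) / (b.factorial : ℂ))).sub
      ((hasSum_betaPartial 2 b n hp).mul_left
        ((-1) ^ (b + 1 + n) * genHarmonic 1 n / (b.factorial : ℂ)))).add
      ((hasSum_betaPartial 3 b n hp).mul_left ((-1) ^ (b + 1 + n) / (3 * (b.factorial : ℂ)))))
    refine h.congr_fun fun k => ?_
    rw [harmonicJet, show (-1 : ℂ) ^ (b + 1 + n) = (-1) ^ (n + 1) * (-1) ^ b by ring]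
    have hcancel : ∀ A B : ℂ, (-1) ^ (n + 1) * (-1) ^ b * A / (b.factorial : ℂ) *
        ((-1) ^ b * (b.factorial : ℂ) * B) = (-1) ^ (n + 1) * A * B := fun A B => by
      rw [div_mul_eq_mul_div, div_eq_iff hb]
      linear_combination ((-1) ^ (n + 1) * A * B * (b.factorial : ℂ)) * hsq
    have h3 := hcancel (1 / 3) (iteratedDeriv 3 (signedBinom k) n / (p + k) ^ (b + 1))
    rw [hcancel, hcancel, show (-1 : ℂ) ^ (n + 1) * (-1) ^ b / (3 * (b.factorial : ℂ)) =
      (-1) ^ (n + 1) * (-1) ^ b * (1 / 3) / (b.factorial : ℂ) by field_simp, h3]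
    ring
  -- The first `n + 1` terms are the finite sum of the statement; the rest are the terms sought.
  have htail := (hasSum_nat_add_iff' (n + 1)).2 hall
  have hhead : ∑ k ∈ Finset.range (n + 1), (-1) ^ (n + 1) * harmonicJet n (signedBinom k) /
      (p + k) ^ (b + 1) = -((-1) ^ n / 3 * ∑ k ∈ Finset.range (n + 1),
        (-1) ^ k / (p + k) ^ (b + 1) * (n.choose k : ℂ) *
          (cubicHarmonic n - cubicHarmonic (n - k))) := by
    rw [Finset.mul_sum, ← Finset.sum_neg_distrib]
    refine Finset.sum_congr rfl fun k hk => ?_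
    rw [harmonicJet_signedBinom_of_le (Nat.lt_succ_iff.1 (Finset.mem_range.1 hk))]
    ring
  rw [hhead, sub_neg_eq_add, add_comm (_ + _) (_ / 3 * _), ← add_assoc, ← add_sub_assoc] at htail
  refine htail.congr_fun fun j => ?_
  rw [harmonicJet_signedBinom_of_gt,
    show p + ((j + (n + 1) : ℕ) : ℂ) = p + n + ((j + 1 : ℕ) : ℂ) by push_cast; ring,
    ← mul_div_assoc, ← mul_assoc, pow_succ (-1 : ℂ) n]
  rw [show (-1 : ℂ) ^ n * -1 * ((-1) ^ n * -1) = 1 by linear_combination hsqn, one_mul, div_div]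
  congr 1
  ring
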